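/- Let $k$ be a field and $A$ a finite-dimensional $k$-algebra; modules are left modules and $D=\operatorname{Hom}_k(-,k)$. A finitely generated $A$-module $G$ is *Gorenstein-projective* if $G\cong\operatorname{Ker}(P^0\to P^1)$ for an exact complex $\cdots\to P^{-1}\to P^0\to P^1\to\cdots$ of finitely generated projective $A$-modules that stays exact under $\operatorname{Hom}_A(-,Q)$ for every finitely generated projective $Q$. Assume that $A$ is of finite CM-type, i.e. there are, up to isomorphism, only finitely many indecomposable finitely generated Gorenstein-projective modules $E_1,\dots,E_n$ (pairwise non-isomorphic). Put $E=\bigoplus_{i=1}^nE_i$ and let $\Lambda=A(\mathrm{Gproj})=\operatorname{End}_A(E)^{op}$ be the CM-Auslander algebra. Then $\operatorname{Hom}_A(E,M)$ and $D\operatorname{Hom}_A(G,E)$ are left $\Lambda$-modules for all $A$-modules $M$, $G$. Let $M$ be a finitely generated $A$-module and let $$G_1\xrightarrow{f}G_0\to M\to 0$$ be a minimal proper Gorenstein-projective presentation of $M$: an exact sequence with $G_0,G_1$ Gorenstein-projective such that $\operatorname{Hom}_A(G,G_1)\to\operatorname{Hom}_A(G,G_0)\to\operatorname{Hom}_A(G,M)\to0$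 is exact for every Gorenstein-projective $G$, and such that $G_0\to M$ and $G_1\to\operatorname{Im}f$ are right minimal (a map $g\colon X\to Y$ is right minimal if every $h\in\operatorname{End}(X)$ with $gh=g$ is an automorphism). Put $$\tau_GM=\operatorname{Ker}\big(D\operatorname{Hom}_A(G_1,E)\to D\operatorname{Hom}_A(G_0,E)\big),$$ and call $M$ *$\tau_G$-rigid* if $\operatorname{Hom}_\Lambda(\operatorname{Hom}_A(E,M),\tau_GM)=0$. Let $\tau$ be the Auslander–Reiten translation of $\Lambda$, i.e. $\tau N=\operatorname{Ker}\big(D\operatorname{Hom}_\Lambda(P_1,\Lambda)\to D\operatorname{Hom}_\Lambda(P_0,\Lambda)\big)$ for a minimal projective presentation $P_1\to P_0\to N\to0$ by finitely generated projective modules, and call $N$ *$\tau$-rigid* if $\operatorname{Hom}_\Lambda(N,\tau N)=0$. Let $\operatorname{Gen}_GM$ be the class of $A$-modules $Y$ for which there is a surjection $T_0\to Y$, with $T_0$ a direct summand of a direct sum of copies of $M$, that stays surjective under $\operatorname{Hom}_A(G,-)$ for every Gorenstein-projective $G$. For $\Lambda$-modules $X$ and $T$ write $\overline{\operatorname{Hom}}_\Lambda(X,T)=0$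 if every $\Lambda$-map $X\to T$ factors through a finitely generated injective $\Lambda$-module. Then: 1. $M$ is $\tau_G$-rigid if and only if $\operatorname{Hom}_A(f,M)\colon\operatorname{Hom}_A(G_0,M)\to\operatorname{Hom}_A(G_1,M)$ is surjective. 2. $M$ is $\tau_G$-rigid if and only if $\operatorname{Hom}_A(E,M)$ is a $\tau$-rigid $\Lambda$-module. 3. $\operatorname{Hom}_A(E,M)$ has a minimal projective presentation, and $\tau_GM\cong\tau\operatorname{Hom}_A(E,M)$ as $\Lambda$-modules, whichever such presentation is used to compute $\tau$. 4. If $M$ is $\tau_G$-rigid, then $\overline{\operatorname{Hom}}_\Lambda(\operatorname{Hom}_A(E,Y),\tau_GM)=0$ for every $Y\in\operatorname{Gen}_GM$; moreover $\operatorname{Hom}_A(E,Y)$ is a finitely generated $\Lambda$-module whenever $Y$ is finitely generated. In particular $\operatorname{Hom}_A(E,\operatorname{Gen}_GM\cap\operatorname{mod}A)\subseteq{}^{\perp_0}(\underline{\tau_GM})=\{X\in\operatorname{mod}\Lambda\mid\overline{\operatorname{Hom}}_\Lambda(X,\tau_GM)=0\}$. -/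

import Mathlib

open scoped DirectSum

universe u

namespace GorensteinTau

/-! ### Gorenstein-projective modules -/

section Modules

/-- A finitely generated module `G` is Gorenstein-projective if there is an exact complex
`⋯ → P (-1) → P 0 → P 1 → ⋯` of finitely generated projective modules that stays exact under
`Hom(-, Q)` for every finitely generated projective `Q`, with `G ≅ Ker (P 0 → P 1)`. -/
def IsGorensteinProjective (A : Type u) [Ring A] (G : Type u) [AddCommGroup G] [Module A G] :
    Prop :=
  ∃ (P : ℤ → ModuleCat.{u} A) (d : ∀ n : ℤ, P n →ₗ[A] P (n + 1)),
    (∀ n, Module.Finite A (P n) ∧ Module.Projective A (P n)) ∧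
    (∀ n, Function.Exact (d n) (d (n + 1))) ∧
    (∀ (Q : Type u) [AddCommGroup Q] [Module A Q], Module.Finite A Q → Module.Projective A Q →
      ∀ n, Function.Exact (fun h : P (n + 1 + 1) →ₗ[A] Q => h ∘ₗ d (n + 1))
        (fun h : P (n + 1) →ₗ[A] Q => h ∘ₗ d n)) ∧
    Nonempty (G ≃ₗ[A] LinearMap.ker (d 0))

/-- A module is indecomposable if it is nonzero and is not the internal direct sum of two nonzero
submodules. -/
def IsIndecomposableModule (A : Type u) [Ring A] (G : Type u) [AddCommGroup G] [Module A G] :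
    Prop :=
  Nontrivial G ∧ ∀ p q : Submodule A G, IsCompl p q → p = ⊥ ∨ q = ⊥

/-- `E` is a Gorenstein-projective generator of an algebra of finite CM-type: there is a finite
family containing exactly one module from each isomorphism class of indecomposable
(finitely generated) Gorenstein-projective modules, and `E` is its direct sum. In particular, the
existence of such an `E` says exactly that `A` is of finite CM-type. -/
def IsGorensteinProjectiveGenerator (A : Type u) [Ring A] (E : Type u) [AddCommGroup E]
    [Module A E] : Prop :=
  ∃ (n : ℕ) (F : Fin n → ModuleCat.{u} A),
    (∀ i, IsGorensteinProjective A (F i) ∧ IsIndecomposableModule A (F i)) ∧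
    (∀ i j, Nonempty (F i ≃ₗ[A] F j) → i = j) ∧
    (∀ (G : Type u) [AddCommGroup G] [Module A G], IsGorensteinProjective A G →
      IsIndecomposableModule A G → ∃ i, Nonempty (G ≃ₗ[A] F i)) ∧
    Nonempty (E ≃ₗ[A] ⨁ i, F i)

/-- A map `f : X → Y` is right minimal if every endomorphism `h` of `X` with `f ∘ h = f` is an
automorphism. -/
def RightMinimal {R : Type u} [Ring R] {X Y : Type u} [AddCommGroup X] [Module R X]
    [AddCommGroup Y] [Module R Y] (f : X →ₗ[R] Y) : Prop :=
  ∀ h : X →ₗ[R] X, f ∘ₗ h = f → Function.Bijective h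

/-- A minimal proper Gorenstein-projective presentation `G₁ → G₀ → M → 0` of `M`: it is exact, it
stays exact under `Hom(G, -)` for every Gorenstein-projective `G` (so that `G₀ → M` and
`G₁ → Im f` are right approximations by Gorenstein-projective modules), and these two
approximations are right minimal. -/
structure MinimalGprojPresentation (A : Type u) [Ring A] (M : Type u) [AddCommGroup M]
    [Module A M] where
  G₁ : ModuleCat.{u} A
  G₀ : ModuleCat.{u} A
  f : G₁ →ₗ[A] G₀
  π : G₀ →ₗ[A] M
  gproj₁ : IsGorensteinProjective A G₁
  gproj₀ : IsGorensteinProjective A G₀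
  exact : Function.Exact f π
  surjective : Function.Surjective π
  proper_exact : ∀ (G : Type u) [AddCommGroup G] [Module A G], IsGorensteinProjective A G →
    Function.Exact (fun h : G →ₗ[A] G₁ => f ∘ₗ h) (fun h : G →ₗ[A] G₀ => π ∘ₗ h)
  proper_surjective : ∀ (G : Type u) [AddCommGroup G] [Module A G], IsGorensteinProjective A G →
    Function.Surjective (fun h : G →ₗ[A] G₀ => π ∘ₗ h)
  minimal₁ : RightMinimal f.rangeRestrict
  minimal₀ : RightMinimal π

/-- `Y ∈ Gen_G M`: there is a `G`-epimorphism `T₀ → Y` (a surjection staying surjective under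
`Hom(G, -)` for every Gorenstein-projective `G`) with `T₀ ∈ Add M`, that is, `T₀` is a direct
summand of a direct sum of copies of `M`. -/
def GenG (A : Type u) [Ring A] (M Y : Type u) [AddCommGroup M] [Module A M] [AddCommGroup Y]
    [Module A Y] : Prop :=
  ∃ (I : Type u) (T₀ : ModuleCat.{u} A) (s : T₀ →ₗ[A] (I →₀ M)) (r : (I →₀ M) →ₗ[A] T₀)
    (p : T₀ →ₗ[A] Y),
    r ∘ₗ s = LinearMap.id ∧ Function.Surjective p ∧
    ∀ (G : Type u) [AddCommGroup G] [Module A G], IsGorensteinProjective A G →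
      Function.Surjective (fun h : G →ₗ[A] T₀ => p ∘ₗ h)

/-- Vanishing of `Hom` in the stable category modulo injectives: every map `X → T` factors through
a finitely generated injective module. -/
def InjStableHomZero (R : Type u) [Ring R] (X T : Type u) [AddCommGroup X] [Module R X]
    [AddCommGroup T] [Module R T] : Prop :=
  ∀ φ : X →ₗ[R] T, ∃ (I : ModuleCat.{u} R) (a : X →ₗ[R] I) (b : I →ₗ[R] T),
    Module.Finite R I ∧ Module.Injective R I ∧ b ∘ₗ a = φ

end Modules

/-! ### The Auslander–Reiten translation of an algebra -/

section AuslanderReiten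

/-- A minimal projective presentation `P₁ → P₀ → N → 0` of `N` by finitely generated projective
modules: `P₀ → N` and `P₁ → Im σ` are right minimal epimorphisms (projective covers). -/
structure MinimalProjPresentation (B : Type u) [Ring B] (N : Type u) [AddCommGroup N]
    [Module B N] where
  P₁ : ModuleCat.{u} B
  P₀ : ModuleCat.{u} B
  σ : P₁ →ₗ[B] P₀
  π : P₀ →ₗ[B] N
  finite₁ : Module.Finite B P₁
  finite₀ : Module.Finite B P₀
  projective₁ : Module.Projective B P₁
  projective₀ : Module.Projective B P₀
  exact : Function.Exact σ π
  surjective : Function.Surjective π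
  minimal₁ : RightMinimal σ.rangeRestrict
  minimal₀ : RightMinimal π

variable (k : Type u) [Field k] (B : Type u) [Ring B] [Algebra k B]

/-- The left `B`-module `D Hom_B(P, B)` with `D = Hom_k(-, k)`; here `Hom_B(P, B)` is a right
`B`-module by right multiplication on its values. -/
def DHomRegular (P : Type u) [AddCommGroup P] [Module B P] : Type u :=
  Module.Dual k (P →ₗ[B] B)

instance (P : Type u) [AddCommGroup P] [Module B P] : AddCommGroup (DHomRegular k B P) :=
  inferInstanceAs (AddCommGroup (Module.Dual k (P →ₗ[B] B)))

/-- Right multiplication by `b` on the values of maps `P → B`. -/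
def rightMul (P : Type u) [AddCommGroup P] [Module B P] (b : B) :
    (P →ₗ[B] B) →ₗ[k] (P →ₗ[B] B) where
  toFun h :=
    { toFun := fun p => h p * b
      map_add' := fun p q => by rw [map_add, add_mul]
      map_smul' := fun c p => by
        rw [map_smul, smul_eq_mul, smul_eq_mul, mul_assoc, RingHom.id_apply] }
  map_add' g h := LinearMap.ext fun p => add_mul (g p) (h p) b
  map_smul' c h := LinearMap.ext fun p => smul_mul_assoc c (h p) b

/-- An element of `D Hom_B(P, B)` as a functional. -/
abbrev DHomRegular.toDual {P : Type u} [AddCommGroup P] [Module B P] (φ : DHomRegular k B P) :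
    Module.Dual k (P →ₗ[B] B) := φ

/-- `(b • φ)(h) = φ(h · b)`. -/
instance (P : Type u) [AddCommGroup P] [Module B P] : Module B (DHomRegular k B P) where
  smul b φ := φ.toDual ∘ₗ rightMul k B P b
  one_smul φ := LinearMap.ext fun h =>
    congrArg φ.toDual (LinearMap.ext fun p => mul_one (h p))
  mul_smul b c φ := LinearMap.ext fun h =>
    congrArg φ.toDual (LinearMap.ext fun p => (mul_assoc (h p) b c).symm)
  smul_zero _ := rfl
  smul_add _ _ _ := rfl
  add_smul b c φ := LinearMap.ext fun h => by
    have e : rightMul k B P (b + c) h = rightMul k B P b h + rightMul k B P c h :=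
      LinearMap.ext fun p => mul_add (h p) b c
    exact (congrArg φ.toDual e).trans (map_add φ.toDual _ _)
  zero_smul φ := LinearMap.ext fun h => by
    have e : rightMul k B P 0 h = 0 := LinearMap.ext fun p => mul_zero (h p)
    exact (congrArg φ.toDual e).trans (map_zero φ.toDual)

/-- The map `D Hom_B(P, B) → D Hom_B(Q, B)` induced by `σ : P → Q`. -/
def DHomRegular.map {P Q : Type u} [AddCommGroup P] [Module B P] [AddCommGroup Q] [Module B Q]
    (σ : P →ₗ[B] Q) : DHomRegular k B P →ₗ[B] DHomRegular k B Q where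
  toFun φ := φ.toDual ∘ₗ LinearMap.lcomp k B σ
  map_add' _ _ := rfl
  map_smul' _ _ := LinearMap.ext fun _ => rfl

variable {B} {N : Type u} [AddCommGroup N] [Module B N]

/-- The Auslander–Reiten translate `τ N = D Tr N`, that is, the kernel of
`D Hom_B(P₁, B) → D Hom_B(P₀, B)` for a minimal projective presentation `P₁ → P₀ → N → 0`. -/
abbrev tau (Q : MinimalProjPresentation B N) : Submodule B (DHomRegular k B Q.P₁) :=
  LinearMap.ker (DHomRegular.map k B Q.σ)

/-- `N` is `τ`-rigid if `Hom_B(N, τ N) = 0`. -/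
def IsTauRigid (B : Type u) [Ring B] [Algebra k B] (N : Type u) [AddCommGroup N] [Module B N] :
    Prop :=
  ∃ Q : MinimalProjPresentation B N, ∀ φ : N →ₗ[B] tau k Q, φ = 0

end AuslanderReiten

/-! ### The relative translation -/

section Relative

/-- The algebra `End_A(E)ᵒᵖ`; it is the CM-Auslander algebra when `E` is the Gorenstein-projective
generator. -/
abbrev CMAuslander (A : Type u) [Ring A] (E : Type u) [AddCommGroup E] [Module A E] : Type u :=
  (Module.End A E)ᵐᵒᵖ

/-- `Hom_A(E, M)` is a left `End_A(E)ᵒᵖ`-module by precomposition: `c • h = h ∘ c`. -/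
instance (A : Type u) [Ring A] (E : Type u) [AddCommGroup E] [Module A E] (M : Type u)
    [AddCommGroup M] [Module A M] : Module (CMAuslander A E) (E →ₗ[A] M) where
  smul c h := h ∘ₗ (c.unop : E →ₗ[A] E)
  one_smul _ := rfl
  mul_smul _ _ _ := rfl
  smul_zero _ := rfl
  smul_add _ _ _ := rfl
  add_smul _ _ h := LinearMap.ext fun _ => map_add h _ _
  zero_smul h := LinearMap.ext fun _ => map_zero h

variable (k : Type u) [Field k] (A : Type u) [Ring A] [Algebra k A]
  (E : Type u) [AddCommGroup E] [Module k E] [Module A E] [IsScalarTower k A E]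

/-- The left `End_A(E)ᵒᵖ`-module `D Hom_A(G, E)` with `D = Hom_k(-, k)`; here `Hom_A(G, E)` is a
right `End_A(E)ᵒᵖ`-module by postcomposition. -/
def DHom (G : Type u) [AddCommGroup G] [Module A G] : Type u := Module.Dual k (G →ₗ[A] E)

instance (G : Type u) [AddCommGroup G] [Module A G] : AddCommGroup (DHom k A E G) :=
  inferInstanceAs (AddCommGroup (Module.Dual k (G →ₗ[A] E)))

/-- Postcomposition with an endomorphism `c` of `E`. -/
def postComp (G : Type u) [AddCommGroup G] [Module A G] (c : E →ₗ[A] E) :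
    (G →ₗ[A] E) →ₗ[k] (G →ₗ[A] E) where
  toFun h := c ∘ₗ h
  map_add' g h := LinearMap.comp_add g h c
  map_smul' r h := LinearMap.ext fun x => LinearMap.map_smul_of_tower c r (h x)

/-- An element of `D Hom_A(G, E)` as a functional. -/
abbrev DHom.toDual {G : Type u} [AddCommGroup G] [Module A G] (φ : DHom k A E G) :
    Module.Dual k (G →ₗ[A] E) := φ

/-- `(c • φ)(h) = φ(c ∘ h)`. -/
instance (G : Type u) [AddCommGroup G] [Module A G] :
    Module (CMAuslander A E) (DHom k A E G) where
  smul c φ := φ.toDual ∘ₗ postComp k A E G c.unop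
  one_smul _ := rfl
  mul_smul _ _ _ := rfl
  smul_zero _ := rfl
  smul_add _ _ _ := rfl
  add_smul b c φ := LinearMap.ext fun h =>
    map_add φ.toDual (postComp k A E G b.unop h) (postComp k A E G c.unop h)
  zero_smul φ := LinearMap.ext fun _ => map_zero φ.toDual

/-- The map `D Hom_A(G, E) → D Hom_A(H, E)` induced by `f : G → H`. -/
def DHom.map {G H : Type u} [AddCommGroup G] [Module A G] [AddCommGroup H] [Module A H]
    (f : G →ₗ[A] H) : DHom k A E G →ₗ[CMAuslander A E] DHom k A E H where
  toFun φ := φ.toDual ∘ₗ LinearMap.lcomp k E f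
  map_add' _ _ := rfl
  map_smul' _ _ := LinearMap.ext fun _ => rfl

/-- The relative translate `τ_G M`, that is, the kernel of `D Hom_A(G₁, E) → D Hom_A(G₀, E)` for a
minimal proper Gorenstein-projective presentation `G₁ → G₀ → M → 0`. -/
abbrev tauG {M : Type u} [AddCommGroup M] [Module A M] (P : MinimalGprojPresentation A M) :
    Submodule (CMAuslander A E) (DHom k A E P.G₁) :=
  LinearMap.ker (DHom.map k A E P.f)

/-- `M` is `τ_G`-rigid if `Hom(Hom_A(E, M), τ_G M) = 0` over `End_A(E)ᵒᵖ`. -/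
def IsTauGRigid (M : Type u) [AddCommGroup M] [Module A M] : Prop :=
  ∃ P : MinimalGprojPresentation A M,
    ∀ φ : (E →ₗ[A] M) →ₗ[CMAuslander A E] tauG k A E P, φ = 0

end Relative

end GorensteinTau

/-!
The functor `Hom(E, -)` restricts to an equivalence between the category `add E` of direct
summands of finite direct sums of copies of `E` and the finitely generated
projective modules over `Λ = End(E)ᵒᵖ`, and `D Hom(G, E)` is isomorphic to
`D Hom_Λ(Hom(E, G), Λ)` for `G` in `add E`. Once all Gorenstein-projective modules are known to lie
in `add E`, the functor carries a minimal proper Gorenstein-projective presentation of `M` to a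
minimal projective presentation of `Hom(E, M)` (`homPresentation`). As minimal projective
presentations are unique up to isomorphism, `τ_G M ≅ τ Hom(E, M)` whichever presentations are used
(`nonempty_tauG_equiv`, `MinimalProjPresentation.nonempty_tau_equiv`), and the two notions of
rigidity agree.

That every Gorenstein-projective module lies in `add E` (`IsGorensteinProjectiveGenerator.isInAdd`)
rests on the fact that direct summands of Gorenstein-projective modules are Gorenstein-projective
(`IsGorensteinProjective.of_prod`). The Gorenstein-projective modules are the largest class of
modules in which every member `X` fits into short exact sequences `0 → X → P → X' → 0` and
`0 → X'' → P' → X → 0` that stay exact under `Hom(-, Q)` for `Q` projective, where `P`, `P'` are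
projective and `X'`, `X''` lie in the class again. The direct summands of Gorenstein-projective
modules form such a class, by Schanuel's lemma.

For finitely generated projective `P` over an algebra `B` there is a natural isomorphism
`Hom(X, D Hom(P, B)) ≅ D Hom(P, X)`. Hence the space of maps from `X` to the kernel of
`D Hom(P₁, B) → D Hom(P₀, B)` is dual to the cokernel of `Hom(P₀, X) → Hom(P₁, X)`
(`forall_hom_ker_eq_zero_iff`). For `X = Hom(E, M)` this is the criterion for rigidity.

If `M` is `τ_G`-rigid and `Y ∈ Gen_G M`, then `Hom(E, Y)` is a quotient of a direct summand of a
direct sum of copies of `Hom(E, M)`, so all its maps to `τ_G M` are zero (`GenG.hom_eq_zero`). In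
particular, they factor through an injective module.
-/

namespace GorensteinTau

/-! ### Closure properties of Gorenstein-projective modules -/

section Closure

variable {A : Type u} [Ring A]

/-- `X → P` extends maps into projectives: every map from `X` to a finitely generated projective
module factors through `i`. -/
def ExtendsToProjectives {X P : Type u} [AddCommGroup X] [Module A X] [AddCommGroup P]
    [Module A P] (i : X →ₗ[A] P) : Prop :=
  ∀ (Q : Type u) [AddCommGroup Q] [Module A Q], Module.Finite A Q → Module.Projective A Q →
    ∀ h : X →ₗ[A] Q, ∃ g : P →ₗ[A] Q, g ∘ₗ i = h

/-- There is a short exact sequence `0 → X → P → Y → 0` with `P` finitely generated projective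
which stays exact under `Hom(-, Q)` for every finitely generated projective `Q`: one step of a
complete resolution. -/
def CompleteStep (A : Type u) [Ring A] (X Y : Type u) [AddCommGroup X] [Module A X]
    [AddCommGroup Y] [Module A Y] : Prop :=
  ∃ (P : ModuleCat.{u} A) (i : X →ₗ[A] P) (p : P →ₗ[A] Y),
    Module.Finite A P ∧ Module.Projective A P ∧ Function.Injective i ∧ Function.Exact i p ∧
    Function.Surjective p ∧ ExtendsToProjectives i

/-- A class of modules in which every member can be continued by a `CompleteStep` in both
directions. -/
def IsCompleteClass (C : ModuleCat.{u} A → Prop) : Prop :=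
  ∀ X, C X → (∃ Y, C Y ∧ CompleteStep A X Y) ∧ (∃ Y, C Y ∧ CompleteStep A Y X)

variable {X Y X' Y' : Type u} [AddCommGroup X] [Module A X] [AddCommGroup Y] [Module A Y]
  [AddCommGroup X'] [Module A X'] [AddCommGroup Y'] [Module A Y']

lemma CompleteStep.congr (h : CompleteStep A X Y) (e : X ≃ₗ[A] X') (e' : Y ≃ₗ[A] Y') :
    CompleteStep A X' Y' := by
  obtain ⟨P, i, p, hf, hp, hi, hex, hs, hext⟩ := h
  refine ⟨P, i ∘ₗ e.symm.toLinearMap, e'.toLinearMap ∘ₗ p, hf, hp, hi.comp e.symm.injective,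
    fun x => ?_, e'.surjective.comp hs, fun Q _ _ hQf hQp h => ?_⟩
  · simp only [LinearMap.comp_apply, LinearEquiv.coe_coe, LinearEquiv.map_eq_zero_iff]
    rw [hex x]
    exact ⟨fun ⟨a, ha⟩ => ⟨e a, by simpa using ha⟩, fun ⟨a, ha⟩ => ⟨e.symm a, by simpa using ha⟩⟩
  · obtain ⟨g, hg⟩ := hext Q hQf hQp (h ∘ₗ e.toLinearMap)
    exact ⟨g, LinearMap.ext fun x => by simpa using LinearMap.congr_fun hg (e.symm x)⟩

lemma ExtendsToProjectives.prodMap {P P' : Type u} [AddCommGroup P] [Module A P]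
    [AddCommGroup P'] [Module A P'] {i : X →ₗ[A] P} {i' : X' →ₗ[A] P'}
    (hi : ExtendsToProjectives i) (hi' : ExtendsToProjectives i') :
    ExtendsToProjectives (i.prodMap i') := by
  intro Q _ _ hQf hQp h
  obtain ⟨g, hg⟩ := hi Q hQf hQp (h ∘ₗ LinearMap.inl A X X')
  obtain ⟨g', hg'⟩ := hi' Q hQf hQp (h ∘ₗ LinearMap.inr A X X')
  refine ⟨g.coprod g', ?_⟩
  apply LinearMap.prod_ext
  · ext x; simpa using LinearMap.congr_fun hg x
  · ext x; simpa using LinearMap.congr_fun hg' x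

lemma ExtendsToProjectives.of_prodMap {P P' : Type u} [AddCommGroup P] [Module A P]
    [AddCommGroup P'] [Module A P'] {i : X →ₗ[A] P} {i' : X' →ₗ[A] P'}
    (h : ExtendsToProjectives (i.prodMap i')) : ExtendsToProjectives i := by
  intro Q _ _ hQf hQp f
  obtain ⟨g, hg⟩ := h Q hQf hQp (f ∘ₗ LinearMap.fst A X X')
  refine ⟨g ∘ₗ LinearMap.inl A P P', LinearMap.ext fun x => ?_⟩
  simpa using LinearMap.congr_fun hg (x, 0)

lemma exact_prodMap {P P' : Type u} [AddCommGroup P] [Module A P]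
    [AddCommGroup P'] [Module A P'] {i : X →ₗ[A] P} {p : P →ₗ[A] Y} {i' : X' →ₗ[A] P'}
    {p' : P' →ₗ[A] Y'} (hex : Function.Exact i p) (hex' : Function.Exact i' p') :
    Function.Exact (i.prodMap i') (p.prodMap p') := by
  rintro ⟨x, x'⟩
  simp only [LinearMap.prodMap_apply, Prod.mk_eq_zero, hex x, hex' x', Set.mem_range, Prod.exists,
    Prod.mk.injEq]
  exact ⟨fun ⟨⟨a, ha⟩, b, hb⟩ => ⟨a, b, ha, hb⟩, fun ⟨a, b, ha, hb⟩ => ⟨⟨a, ha⟩, b, hb⟩⟩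

lemma CompleteStep.prod (h : CompleteStep A X Y) (h' : CompleteStep A X' Y') :
    CompleteStep A (X × X') (Y × Y') := by
  obtain ⟨P, i, p, hf, hp, hi, hex, hs, hext⟩ := h
  obtain ⟨P', i', p', hf', hp', hi', hex', hs', hext'⟩ := h'
  refine ⟨ModuleCat.of A (P × P'), i.prodMap i', p.prodMap p',
    inferInstanceAs (Module.Finite A (P × P')), inferInstanceAs (Module.Projective A (P × P')),
    hi.prodMap hi', exact_prodMap hex hex', hs.prodMap hs', hext.prodMap hext'⟩

/-- Consecutive steps splice to a complete resolution. -/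
lemma isGorensteinProjective_of_steps (X : ℤ → ModuleCat.{u} A)
    (h : ∀ n, CompleteStep A (X n) (X (n + 1))) : IsGorensteinProjective A (X 0) := by
  choose P i p hf hp hi hex hs hext using h
  have hker : ∀ n, LinearMap.ker (i (n + 1) ∘ₗ p n) = LinearMap.range (i n) := fun n => by
    rw [LinearMap.ker_comp_of_ker_eq_bot _ (LinearMap.ker_eq_bot.2 (hi _)),
      (LinearMap.exact_iff.1 (hex n))]
  refine ⟨P, fun n => i (n + 1) ∘ₗ p n, fun n => ⟨hf n, hp n⟩, fun n => ?_,
    fun Q _ _ hQf hQp n h => ⟨fun h0 => ?_, ?_⟩, ⟨?_⟩⟩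
  · rw [LinearMap.exact_iff, hker, LinearMap.range_comp_of_range_eq_top _
      (LinearMap.range_eq_top.2 (hs n))]
  · have h1 : ∀ x, h (i (n + 1) x) = 0 := fun x => by
      obtain ⟨y, rfl⟩ := hs n x
      exact LinearMap.congr_fun h0 y
    have h2 : LinearMap.ker (p (n + 1)) ≤ LinearMap.ker h := fun x hx => by
      obtain ⟨y, rfl⟩ := (hex (n + 1) x).1 hx
      exact h1 y
    obtain ⟨g, hg⟩ := hext (n + 1 + 1) Q hQf hQp
      ((LinearMap.ker (p (n + 1))).liftQ h h2 ∘ₗ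
        ((p (n + 1)).quotKerEquivOfSurjective (hs (n + 1))).symm.toLinearMap)
    refine ⟨g, LinearMap.ext fun x => ?_⟩
    have := LinearMap.congr_fun hg (p (n + 1) x)
    simp only [LinearMap.comp_apply, LinearEquiv.coe_coe] at this ⊢
    rw [this]
    have e : ((p (n + 1)).quotKerEquivOfSurjective (hs (n + 1))).symm (p (n + 1) x) =
        Submodule.Quotient.mk x := by
      rw [LinearEquiv.symm_apply_eq]; rfl
    rw [e]; rfl
  · rintro ⟨g, rfl⟩
    refine LinearMap.ext fun x => ?_
    have : p (n + 1) (i (n + 1) (p n x)) = 0 := (hex (n + 1)).apply_apply_eq_zero _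
    simp [this]
  · exact (LinearEquiv.ofInjective (i 0) (hi 0)).trans (LinearEquiv.ofEq _ _ (hker 0).symm)

lemma IsCompleteClass.isGorensteinProjective {C : ModuleCat.{u} A → Prop}
    (hC : IsCompleteClass C) {X : ModuleCat.{u} A} (hX : C X) : IsGorensteinProjective A X := by
  choose up hup using fun X : {X // C X} => (hC X X.2).1
  choose down hdown using fun X : {X // C X} => (hC X X.2).2
  let u : {X // C X} → {X // C X} := fun X => ⟨up X, (hup X).1⟩
  let d : {X // C X} → {X // C X} := fun X => ⟨down X, (hdown X).1⟩
  let S : ℤ → {X // C X}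
    | Int.ofNat n => u^[n] ⟨X, hX⟩
    | Int.negSucc n => d^[n + 1] ⟨X, hX⟩
  refine isGorensteinProjective_of_steps (fun n => (S n).1) fun n => ?_
  rcases n with n | n | n
  · have : S (Int.ofNat n + 1) = u (S (Int.ofNat n)) := Function.iterate_succ_apply' u n _
    rw [this]
    exact (hup _).2
  · exact (hdown ⟨X, hX⟩).2
  · have : S (Int.negSucc (n + 1)) = d (S (Int.negSucc n)) :=
      Function.iterate_succ_apply' d (n + 1) _
    rw [this]
    exact (hdown _).2

lemma IsGorensteinProjective.congr {G G' : Type u} [AddCommGroup G] [Module A G]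
    [AddCommGroup G'] [Module A G'] (h : IsGorensteinProjective A G) (e : G ≃ₗ[A] G') :
    IsGorensteinProjective A G' := by
  obtain ⟨P, d, h1, h2, h3, ⟨e'⟩⟩ := h
  exact ⟨P, d, h1, h2, h3, ⟨e.symm.trans e'⟩⟩

/-- The kernels of a complete resolution form a complete class. -/
lemma IsGorensteinProjective.exists_completeClass {G : Type u} [AddCommGroup G] [Module A G]
    (h : IsGorensteinProjective A G) :
    ∃ C : ModuleCat.{u} A → Prop, IsCompleteClass C ∧ C (ModuleCat.of A G) := by
  obtain ⟨P, d, hP, hex, hQ, ⟨e⟩⟩ := h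
  have step : ∀ n, CompleteStep A (LinearMap.ker (d n)) (LinearMap.ker (d (n + 1))) := by
    intro n
    obtain ⟨m, rfl⟩ : ∃ m, n = m + 1 + 1 := ⟨n - 1 - 1, by ring⟩
    refine ⟨P (m + 1 + 1), Submodule.subtype _,
      (d (m + 1 + 1)).codRestrict _ fun x => (hex _).apply_apply_eq_zero x, (hP _).1, (hP _).2,
      Subtype.val_injective, fun x => ?_, fun x => ?_, fun Q _ _ hQf hQp h => ?_⟩
    · simp only [Submodule.subtype_apply, Set.mem_range, Subtype.exists, exists_prop, exists_eq_right,
        LinearMap.mem_ker]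
      exact Subtype.ext_iff
    · obtain ⟨y, hy⟩ := (hex (m + 1 + 1) x).1 x.2
      exact ⟨y, Subtype.ext hy⟩
    · -- pulled back along `P (m + 1) → Ker`, `h` becomes a cocycle, hence a coboundary
      let q : P (m + 1) →ₗ[A] LinearMap.ker (d (m + 1 + 1)) :=
        (d (m + 1)).codRestrict _ fun x => (hex _).apply_apply_eq_zero x
      have hq : (h ∘ₗ q) ∘ₗ d m = 0 := LinearMap.ext fun x => by
        have : q (d m x) = 0 := Subtype.ext ((hex m).apply_apply_eq_zero x)
        simp [this]
      obtain ⟨g, hg⟩ := (hQ Q hQf hQp m (h ∘ₗ q)).1 hq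
      refine ⟨g, LinearMap.ext fun x => ?_⟩
      obtain ⟨y, hy⟩ := (hex (m + 1) x).1 x.2
      have hx : x = q y := Subtype.ext hy.symm
      rw [hx]
      exact LinearMap.congr_fun hg y
  refine ⟨fun X => ∃ n, Nonempty (X ≃ₗ[A] LinearMap.ker (d n)), ?_, 0, ⟨e⟩⟩
  rintro X ⟨n, ⟨eX⟩⟩
  obtain ⟨m, rfl⟩ : ∃ m, n = m + 1 := ⟨n - 1, by ring⟩
  exact ⟨⟨ModuleCat.of A (LinearMap.ker (d (m + 1 + 1))), ⟨_, ⟨LinearEquiv.refl _ _⟩⟩,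
      (step _).congr eX.symm (LinearEquiv.refl _ _)⟩,
    ⟨ModuleCat.of A (LinearMap.ker (d m)), ⟨_, ⟨LinearEquiv.refl _ _⟩⟩,
      (step _).congr (LinearEquiv.refl _ _) eX.symm⟩⟩

/-- The Gorenstein-projective modules form the largest complete class. -/
lemma isCompleteClass_isGorensteinProjective :
    IsCompleteClass fun X : ModuleCat.{u} A => IsGorensteinProjective A X := by
  intro X hX
  obtain ⟨C, hC, hXC⟩ := hX.exists_completeClass
  obtain ⟨⟨Y, hY, h⟩, ⟨Z, hZ, h'⟩⟩ := hC _ hXC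
  exact ⟨⟨Y, hC.isGorensteinProjective hY, h⟩, ⟨Z, hC.isGorensteinProjective hZ, h'⟩⟩

lemma isGorensteinProjective_of_projective (Q : Type u) [AddCommGroup Q] [Module A Q]
    [Module.Finite A Q] [Module.Projective A Q] : IsGorensteinProjective A Q := by
  have step : CompleteStep A Q Q :=
    ⟨ModuleCat.of A (Q × Q), LinearMap.inl A Q Q, LinearMap.snd A Q Q,
      inferInstanceAs (Module.Finite A (Q × Q)), inferInstanceAs (Module.Projective A (Q × Q)),
      LinearMap.inl_injective, Function.Exact.inl_snd, LinearMap.snd_surjective,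
      fun R _ _ _ _ h => ⟨h ∘ₗ LinearMap.fst A Q Q, rfl⟩⟩
  have hC : IsCompleteClass fun X : ModuleCat.{u} A => X = ModuleCat.of A Q := by
    rintro X rfl
    exact ⟨⟨_, rfl, step⟩, ⟨_, rfl, step⟩⟩
  exact hC.isGorensteinProjective (X := ModuleCat.of A Q) rfl

lemma IsGorensteinProjective.prod (hX : IsGorensteinProjective A X)
    (hY : IsGorensteinProjective A Y) : IsGorensteinProjective A (X × Y) := by
  have hC : IsCompleteClass fun Z : ModuleCat.{u} A => ∃ X Y : ModuleCat.{u} A,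
      IsGorensteinProjective A X ∧ IsGorensteinProjective A Y ∧ Nonempty (Z ≃ₗ[A] X × Y) := by
    rintro Z ⟨X, Y, hX, hY, ⟨e⟩⟩
    obtain ⟨⟨X₁, hX₁, h₁⟩, ⟨X₂, hX₂, h₂⟩⟩ := isCompleteClass_isGorensteinProjective X hX
    obtain ⟨⟨Y₁, hY₁, h₁'⟩, ⟨Y₂, hY₂, h₂'⟩⟩ := isCompleteClass_isGorensteinProjective Y hY
    exact ⟨⟨ModuleCat.of A (X₁ × Y₁), ⟨X₁, Y₁, hX₁, hY₁, ⟨LinearEquiv.refl _ _⟩⟩,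
        (h₁.prod h₁').congr e.symm (LinearEquiv.refl _ _)⟩,
      ⟨ModuleCat.of A (X₂ × Y₂), ⟨X₂, Y₂, hX₂, hY₂, ⟨LinearEquiv.refl _ _⟩⟩,
        (h₂.prod h₂').congr (LinearEquiv.refl _ _) e.symm⟩⟩
  exact hC.isGorensteinProjective (X := ModuleCat.of A (X × Y))
    ⟨ModuleCat.of A X, ModuleCat.of A Y, hX, hY, ⟨LinearEquiv.refl _ _⟩⟩

/-- Schanuel's lemma for left approximations: two monomorphisms out of the same module which
extend along each other have stably isomorphic cokernels. -/
lemma nonempty_equiv_of_extends {G P Z W Z' : Type u} [AddCommGroup G] [Module A G]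
    [AddCommGroup P] [Module A P] [AddCommGroup Z] [Module A Z] [AddCommGroup W] [Module A W]
    [AddCommGroup Z'] [Module A Z'] {i : G →ₗ[A] P} {p : P →ₗ[A] Z} {j : G →ₗ[A] W}
    {q : W →ₗ[A] Z'} (hip : Function.Exact i p) (hp : Function.Surjective p)
    (hjq : Function.Exact j q) (hq : Function.Surjective q)
    {α : W →ₗ[A] P} (hα : α ∘ₗ j = i) {β : P →ₗ[A] W} (hβ : β ∘ₗ i = j) :
    Nonempty ((Z × W) ≃ₗ[A] (Z' × P)) := by
  -- both sides are the pushout `(P × W) / G`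
  let f : P × W →ₗ[A] Z' × P :=
    (q ∘ₗ LinearMap.snd A P W).prod (LinearMap.fst A P W + α ∘ₗ LinearMap.snd A P W)
  let g : P × W →ₗ[A] Z × W :=
    (p ∘ₗ LinearMap.fst A P W).prod (LinearMap.snd A P W + β ∘ₗ LinearMap.fst A P W)
  have hf : Function.Surjective f := by
    rintro ⟨z, x⟩
    obtain ⟨w, rfl⟩ := hq z
    exact ⟨(x - α w, w), by simp [f]⟩
  have hg : Function.Surjective g := by
    rintro ⟨z, x⟩
    obtain ⟨w, rfl⟩ := hp z
    exact ⟨(w, x - β w), by simp [g]⟩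
  have hker : LinearMap.ker g = LinearMap.ker f := by
    ext ⟨x, w⟩
    simp only [f, g, LinearMap.mem_ker, LinearMap.prod_apply, Function.prod, Prod.mk_eq_zero,
      LinearMap.comp_apply, LinearMap.add_apply, LinearMap.fst_apply, LinearMap.snd_apply]
    constructor
    · rintro ⟨h1, h2⟩
      obtain ⟨y, rfl⟩ := (hip x).1 h1
      have hb : β (i y) = j y := LinearMap.congr_fun hβ y
      obtain rfl : w = -j y := by rw [hb] at h2; exact eq_neg_of_add_eq_zero_left h2
      have ha : α (j y) = i y := LinearMap.congr_fun hα y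
      simp [ha, hjq.apply_apply_eq_zero]
    · rintro ⟨h1, h2⟩
      obtain ⟨y, rfl⟩ := (hjq w).1 h1
      have ha : α (j y) = i y := LinearMap.congr_fun hα y
      obtain rfl : x = -i y := by rw [ha] at h2; exact eq_neg_of_add_eq_zero_left h2
      have hb : β (i y) = j y := LinearMap.congr_fun hβ y
      simp [hb, hip.apply_apply_eq_zero]
  exact ⟨(g.quotKerEquivOfSurjective hg).symm.trans
    ((Submodule.quotEquivOfEq _ _ hker).trans (f.quotKerEquivOfSurjective hf))⟩

/-- Schanuel's lemma for epimorphisms which lift along each other. -/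
lemma nonempty_equiv_of_lifts {G P Z W Z' : Type u} [AddCommGroup G] [Module A G]
    [AddCommGroup P] [Module A P] [AddCommGroup Z] [Module A Z] [AddCommGroup W] [Module A W]
    [AddCommGroup Z'] [Module A Z'] {i : Z →ₗ[A] P} {p : P →ₗ[A] G} {j : Z' →ₗ[A] W}
    {q : W →ₗ[A] G} (hip : Function.Exact i p) (hi : Function.Injective i)
    (hjq : Function.Exact j q) (hj : Function.Injective j)
    {α : W →ₗ[A] P} (hα : p ∘ₗ α = q) {β : P →ₗ[A] W} (hβ : q ∘ₗ β = p) :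
    Nonempty ((Z × W) ≃ₗ[A] (Z' × P)) := by
  have ha : ∀ w, p (α w) = q w := fun w => LinearMap.congr_fun hα w
  have hb : ∀ w, q (β w) = p w := fun w => LinearMap.congr_fun hβ w
  -- both sides are the pullback of `p` and `q` inside `P × W`
  let f : Z × W →ₗ[A] P × W :=
    (i ∘ₗ LinearMap.fst A Z W + α ∘ₗ LinearMap.snd A Z W).prod (LinearMap.snd A Z W)
  let g : Z' × P →ₗ[A] P × W :=
    (LinearMap.snd A Z' P).prod (j ∘ₗ LinearMap.fst A Z' P + β ∘ₗ LinearMap.snd A Z' P)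
  have hf : Function.Injective f := by
    rw [← LinearMap.ker_eq_bot, LinearMap.ker_eq_bot']
    rintro ⟨z, w⟩ h
    simp only [f, LinearMap.prod_apply, Function.prod, Prod.mk_eq_zero, LinearMap.comp_apply,
      LinearMap.add_apply, LinearMap.fst_apply, LinearMap.snd_apply] at h
    obtain ⟨h, rfl⟩ := h
    rw [map_zero, add_zero, map_eq_zero_iff _ hi] at h
    simp [h]
  have hg : Function.Injective g := by
    rw [← LinearMap.ker_eq_bot, LinearMap.ker_eq_bot']
    rintro ⟨z, w⟩ h
    simp only [g, LinearMap.prod_apply, Function.prod, Prod.mk_eq_zero, LinearMap.comp_apply,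
      LinearMap.add_apply, LinearMap.fst_apply, LinearMap.snd_apply] at h
    obtain ⟨rfl, h⟩ := h
    rw [map_zero, add_zero, map_eq_zero_iff _ hj] at h
    simp [h]
  have hrange : LinearMap.range f = LinearMap.range g := by
    ext ⟨x, w⟩
    trans p x = q w
    · constructor
      · rintro ⟨⟨z, w'⟩, h⟩
        simp only [f, LinearMap.prod_apply, Function.prod, Prod.mk.injEq, LinearMap.comp_apply,
          LinearMap.add_apply, LinearMap.fst_apply, LinearMap.snd_apply] at h
        obtain ⟨rfl, rfl⟩ := h
        simp [ha, hip.apply_apply_eq_zero]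
      · intro h
        obtain ⟨z, hz⟩ := (hip (x - α w)).1 (by simp [ha, h])
        exact ⟨(z, w), by simp [f, hz]⟩
    · constructor
      · intro h
        obtain ⟨z, hz⟩ := (hjq (w - β x)).1 (by simp [hb, h])
        exact ⟨(z, x), by simp [g, hz]⟩
      · rintro ⟨⟨z, w'⟩, h⟩
        simp only [g, LinearMap.prod_apply, Function.prod, Prod.mk.injEq, LinearMap.comp_apply,
          LinearMap.add_apply, LinearMap.fst_apply, LinearMap.snd_apply] at h
        obtain ⟨rfl, rfl⟩ := h
        simp [hb, hjq.apply_apply_eq_zero]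
  exact ⟨(LinearEquiv.ofInjective f hf).trans ((LinearEquiv.ofEq _ _ hrange).trans
    (LinearEquiv.ofInjective g hg).symm)⟩

/-- The extension property of the kernel of a projective presentation of `G`, that is, the
vanishing of `Ext¹(G, Q)`, does not depend on the presentation. -/
lemma ExtendsToProjectives.of_lifts {G P Z W Z' : Type u} [AddCommGroup G] [Module A G]
    [AddCommGroup P] [Module A P] [AddCommGroup Z] [Module A Z] [AddCommGroup W] [Module A W]
    [AddCommGroup Z'] [Module A Z'] {i : Z →ₗ[A] P} {p : P →ₗ[A] G} {j : Z' →ₗ[A] W}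
    {q : W →ₗ[A] G} (hi : ExtendsToProjectives i) (hip : Function.Exact i p)
    (hjq : Function.Exact j q) (hj : Function.Injective j)
    {α : W →ₗ[A] P} (hα : p ∘ₗ α = q) {β : P →ₗ[A] W} (hβ : q ∘ₗ β = p) :
    ExtendsToProjectives j := by
  intro Q _ _ hQf hQp h
  have ha : ∀ w, p (α w) = q w := fun w => LinearMap.congr_fun hα w
  have hb : ∀ w, q (β w) = p w := fun w => LinearMap.congr_fun hβ w
  -- factor a map into `W` killed by `q` through `j`
  have key : ∀ {T : Type u} [AddCommGroup T] [Module A T] (t : T →ₗ[A] W),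
      (∀ x, q (t x) = 0) → ∃ t' : T →ₗ[A] Z', j ∘ₗ t' = t := fun t ht => by
    let e := LinearEquiv.ofInjective j hj
    refine ⟨e.symm.toLinearMap ∘ₗ t.codRestrict (LinearMap.range j) fun x => (hjq _).1 (ht x),
      LinearMap.ext fun x => ?_⟩
    exact congrArg Subtype.val (e.apply_symm_apply _)
  obtain ⟨v, hv⟩ := key (β ∘ₗ i) fun x => by simp [hb, hip.apply_apply_eq_zero]
  obtain ⟨w, hw⟩ := key (LinearMap.id - β ∘ₗ α) fun x => by simp [hb, ha]
  obtain ⟨H, hH⟩ := hi Q hQf hQp (h ∘ₗ v)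
  refine ⟨H ∘ₗ α + h ∘ₗ w, LinearMap.ext fun x => ?_⟩
  obtain ⟨z, hz⟩ := (hip (α (j x))).1 (by rw [ha, hjq.apply_apply_eq_zero])
  have h1 : H (i z) = h (v z) := LinearMap.congr_fun hH z
  have h2 : v z + w (j x) = x := hj <| by
    have e1 : j (v z) = β (i z) := LinearMap.congr_fun hv z
    have e2 : j (w (j x)) = j x - β (α (j x)) := LinearMap.congr_fun hw (j x)
    rw [map_add, e1, e2, hz]
    abel
  simp only [LinearMap.comp_apply, LinearMap.add_apply]
  rw [← hz, h1, ← map_add, h2]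

lemma IsGorensteinProjective.finite [IsNoetherianRing A] {G : Type u} [AddCommGroup G]
    [Module A G] (h : IsGorensteinProjective A G) : Module.Finite A G := by
  obtain ⟨P, d, hP, -, -, ⟨e⟩⟩ := h
  have := (hP 0).1
  exact Module.Finite.equiv e.symm

end Closure

/-! ### Direct summands of Gorenstein-projective modules -/

section Summands

lemma isScalarTower_compHom (k A X : Type u) [Field k] [Ring A] [Algebra k A] [AddCommGroup X]
    [Module A X] :
    letI := Module.compHom X (algebraMap k A)
    IsScalarTower k A X :=
  letI := Module.compHom X (algebraMap k A)
  ⟨fun c a x => by rw [Algebra.smul_def, mul_smul]; rfl⟩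

variable (k : Type u) [Field k] {A : Type u} [Ring A] [Algebra k A] [Module.Finite k A]

include k in
lemma isNoetherianRing_of_finite_algebra : IsNoetherianRing A :=
  isNoetherian_of_tower k inferInstance

lemma finite_hom (X Y : Type u) [AddCommGroup X] [Module k X] [Module A X] [IsScalarTower k A X]
    [AddCommGroup Y] [Module k Y] [Module A Y] [IsScalarTower k A Y] [Module.Finite A X]
    [Module.Finite A Y] : Module.Finite k (X →ₗ[A] Y) := by
  have : Module.Finite k X := Module.Finite.trans A X
  have : Module.Finite k Y := Module.Finite.trans A Y
  exact Module.Finite.of_injective (LinearMap.restrictScalarsₗ k A X Y k)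
    (LinearMap.restrictScalars_injective k)

include k in
/-- Every finitely generated module has a left approximation by a finitely generated projective
module: spanning maps `X → A` are the components of a map `X → Aⁿ` with this property. -/
lemma exists_extendsToProjectives (X : Type u) [AddCommGroup X] [Module A X]
    [Module.Finite A X] :
    ∃ (U : ModuleCat.{u} A) (j : X →ₗ[A] U), Module.Finite A U ∧ Module.Projective A U ∧
      ExtendsToProjectives j := by
  let _ : Module k X := Module.compHom X (algebraMap k A)
  have := isScalarTower_compHom k A X
  have := finite_hom k (A := A) X A
  obtain ⟨n, f, hf⟩ := Module.Finite.exists_fin (R := k) (M := X →ₗ[A] A)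
  refine ⟨ModuleCat.of A (Fin n → A), LinearMap.pi f,
    inferInstanceAs (Module.Finite A (Fin n → A)),
    inferInstanceAs (Module.Projective A (Fin n → A)), fun Q _ _ hQf hQp h => ?_⟩
  obtain ⟨m, r, s, -, -, hrs⟩ := Module.Finite.exists_comp_eq_id_of_projective A Q
  have key : ∀ φ : X →ₗ[A] A, ∃ g : (Fin n → A) →ₗ[A] A, g ∘ₗ LinearMap.pi f = φ := fun φ => by
    obtain ⟨c, rfl⟩ := (Submodule.mem_span_range_iff_exists_fun k).1
      (hf ▸ Submodule.mem_top : φ ∈ Submodule.span k (Set.range f))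
    refine ⟨∑ i, c i • LinearMap.proj i, LinearMap.ext fun x => ?_⟩
    simp
  choose g hg using fun i => key (LinearMap.proj i ∘ₗ s ∘ₗ h)
  refine ⟨r ∘ₗ LinearMap.pi g, LinearMap.ext fun x => ?_⟩
  have : LinearMap.pi g (LinearMap.pi f x) = s (h x) :=
    funext fun i => LinearMap.congr_fun (hg i) x
  exact (congrArg r this).trans (LinearMap.congr_fun hrs (h x))

include k in
/-- A direct summand of a Gorenstein-projective module is Gorenstein-projective. The summands form
a complete class: a left approximation of `X × Y` splits as the product of those of `X` and `Y`,
and by Schanuel's lemma its cokernel is Gorenstein-projective up to projective summands; dually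
for syzygies. -/
lemma IsGorensteinProjective.of_prod {X Y : Type u} [AddCommGroup X] [Module A X]
    [AddCommGroup Y] [Module A Y] (h : IsGorensteinProjective A (X × Y)) :
    IsGorensteinProjective A X := by
  have := isNoetherianRing_of_finite_algebra k (A := A)
  have hC : IsCompleteClass fun X : ModuleCat.{u} A => ∃ Y : ModuleCat.{u} A,
      IsGorensteinProjective A (X × Y) := by
    rintro X ⟨Y, hXY⟩
    have := hXY.finite
    have : Module.Finite A X := .of_surjective _ (LinearMap.fst_surjective (R := A) (M₂ := Y))
    have : Module.Finite A Y := .of_surjective _ (LinearMap.snd_surjective (R := A) (M := X))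
    obtain ⟨⟨Z, hZ, P, i, p, hPf, hPp, hi, hip, hp, hext⟩,
      ⟨Z', hZ', P', i', p', hPf', hPp', hi', hip', hp', hext'⟩⟩ :=
      isCompleteClass_isGorensteinProjective (ModuleCat.of A (X × Y)) hXY
    constructor
    · obtain ⟨U, j, hUf, hUp, hj⟩ := exists_extendsToProjectives k (A := A) X
      obtain ⟨V, l, hVf, hVp, hl⟩ := exists_extendsToProjectives k (A := A) Y
      obtain ⟨α, hα⟩ := hj.prodMap hl P hPf hPp i
      obtain ⟨β, hβ⟩ := hext (U × V) inferInstance inferInstance (j.prodMap l)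
      have hinj : Function.Injective (j.prodMap l) := by
        refine Function.Injective.of_comp (f := α) ?_
        rw [← LinearMap.coe_comp, hα]
        exact hi
      have hjinj : Function.Injective j := fun x y hxy => by
        have := @hinj (x, 0) (y, 0) (by simp [hxy])
        exact congrArg Prod.fst this
      obtain ⟨e⟩ := nonempty_equiv_of_extends hip hp
        (exact_prodMap (LinearMap.exact_map_mkQ_range j) (LinearMap.exact_map_mkQ_range l))
        ((Submodule.mkQ_surjective _).prodMap (Submodule.mkQ_surjective _)) hα hβ
      refine ⟨ModuleCat.of A (U ⧸ LinearMap.range j),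
        ⟨ModuleCat.of A ((V ⧸ LinearMap.range l) × P), ?_⟩, U, j, (LinearMap.range j).mkQ,
        hUf, hUp, hjinj, LinearMap.exact_map_mkQ_range j, Submodule.mkQ_surjective _, hj⟩
      exact (hZ.prod (isGorensteinProjective_of_projective (U × V))).congr
        (e.trans (LinearEquiv.prodAssoc A _ _ _))
    · obtain ⟨m, f, hf⟩ := Module.Finite.exists_fin' A X
      obtain ⟨n, g, hg⟩ := Module.Finite.exists_fin' A Y
      obtain ⟨α, hα⟩ := Module.projective_lifting_property p' (f.prodMap g) hp'
      obtain ⟨β, hβ⟩ := Module.projective_lifting_property (f.prodMap g) p' (hf.prodMap hg)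
      have hex := exact_prodMap (LinearMap.exact_subtype_ker_map f)
        (LinearMap.exact_subtype_ker_map g)
      have hinj := Function.Injective.prodMap (Submodule.subtype_injective (LinearMap.ker f))
        (Submodule.subtype_injective (LinearMap.ker g))
      obtain ⟨e⟩ := nonempty_equiv_of_lifts hip' hi' hex hinj hα hβ
      refine ⟨ModuleCat.of A (LinearMap.ker f), ⟨ModuleCat.of A (LinearMap.ker g × P'), ?_⟩,
        ModuleCat.of A (Fin m → A), (LinearMap.ker f).subtype, f,
        inferInstanceAs (Module.Finite A (Fin m → A)),
        inferInstanceAs (Module.Projective A (Fin m → A)), Submodule.subtype_injective _,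
        LinearMap.exact_subtype_ker_map f, hf, (hext'.of_lifts hip' hex hinj hα hβ).of_prodMap⟩
      exact (hZ'.prod (isGorensteinProjective_of_projective ((Fin m → A) × (Fin n → A)))).congr
        (e.trans (LinearEquiv.prodAssoc A _ _ _))
  exact hC.isGorensteinProjective (X := ModuleCat.of A X) ⟨ModuleCat.of A Y, h⟩

end Summands

/-! ### Gorenstein-projective modules are summands of sums of copies of the generator -/

section AddClosure

variable {A : Type u} [Ring A]

/-- `G` is a direct summand of a finite direct sum of copies of `E`, encoded by the components
`E → G → E` of the retraction and the section. -/
def IsInAdd (E G : Type u) [AddCommGroup E] [Module A E] [AddCommGroup G] [Module A G] : Prop :=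
  ∃ (n : ℕ) (r : Fin n → E →ₗ[A] G) (s : Fin n → G →ₗ[A] E), ∑ i, r i ∘ₗ s i = LinearMap.id

variable {E G H : Type u} [AddCommGroup E] [Module A E] [AddCommGroup G] [Module A G]
  [AddCommGroup H] [Module A H]

lemma IsInAdd.of_retract {r : E →ₗ[A] G} {s : G →ₗ[A] E} (h : r ∘ₗ s = LinearMap.id) :
    IsInAdd (A := A) E G :=
  ⟨1, fun _ => r, fun _ => s, by simpa using h⟩

lemma IsInAdd.congr (h : IsInAdd (A := A) E G) (e : G ≃ₗ[A] H) : IsInAdd (A := A) E H := by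
  obtain ⟨n, r, s, hrs⟩ := h
  refine ⟨n, fun i => e.toLinearMap ∘ₗ r i, fun i => s i ∘ₗ e.symm.toLinearMap,
    LinearMap.ext fun x => ?_⟩
  have := congrArg e (LinearMap.congr_fun hrs (e.symm x))
  simpa [LinearMap.sum_apply] using this

lemma IsInAdd.prod (hG : IsInAdd (A := A) E G) (hH : IsInAdd (A := A) E H) :
    IsInAdd (A := A) E (G × H) := by
  obtain ⟨m, r, s, hrs⟩ := hG
  obtain ⟨n, r', s', hrs'⟩ := hH
  refine ⟨m + n, Fin.addCases (fun i => LinearMap.inl A G H ∘ₗ r i)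
      (fun i => LinearMap.inr A G H ∘ₗ r' i),
    Fin.addCases (fun i => s i ∘ₗ LinearMap.fst A G H) (fun i => s' i ∘ₗ LinearMap.snd A G H),
    LinearMap.ext fun ⟨x, y⟩ => ?_⟩
  have hx := LinearMap.congr_fun hrs x
  have hy := LinearMap.congr_fun hrs' y
  simp only [LinearMap.sum_apply, LinearMap.comp_apply, LinearMap.id_apply] at hx hy
  rw [LinearMap.sum_apply, Fin.sum_univ_add]
  ext <;> simp [Prod.fst_sum, Prod.snd_sum, hx, hy]

/-- By induction on the dimension, every Gorenstein-projective module is a finite direct sum of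
indecomposable modules, which are Gorenstein-projective because they are direct summands. -/
lemma IsGorensteinProjectiveGenerator.isInAdd (k : Type u) [Field k] [Algebra k A]
    [Module.Finite k A] (hE : IsGorensteinProjectiveGenerator A E)
    (hG : IsGorensteinProjective A G) : IsInAdd (A := A) E G := by
  have := isNoetherianRing_of_finite_algebra k (A := A)
  obtain ⟨m, F, -, -, hF, ⟨e⟩⟩ := hE
  have key : ∀ (n : ℕ) (G : Type u) [AddCommGroup G] [Module A G] [Module k G]
      [IsScalarTower k A G], IsGorensteinProjective A G → Module.finrank k G = n →
      IsInAdd (A := A) E G := by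
    intro n
    induction n using Nat.strong_induction_on with
    | _ n ih =>
    intro G _ _ _ _ hG hn
    have := hG.finite
    have : Module.Finite k G := Module.Finite.trans A G
    rcases subsingleton_or_nontrivial G with hs | hs
    · exact ⟨0, 0, 0, LinearMap.ext fun x => Subsingleton.elim _ _⟩
    by_cases hi : IsIndecomposableModule A G
    · obtain ⟨i, ⟨e'⟩⟩ := hF G hG hi
      refine (IsInAdd.of_retract (r := DirectSum.component A (Fin m) (fun i => F i) i ∘ₗ
        e.toLinearMap) (s := e.symm.toLinearMap ∘ₗ DirectSum.lof A (Fin m) (fun i => F i) i)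
        (LinearMap.ext fun x => ?_)).congr e'.symm
      simp [DirectSum.component.lof_self]
    · have : ∃ p q : Submodule A G, IsCompl p q ∧ p ≠ ⊥ ∧ q ≠ ⊥ := by
        by_contra! hcon
        exact hi ⟨hs, fun p q hpq => or_iff_not_imp_left.2 (hcon p q hpq)⟩
      obtain ⟨p, q, hpq, hp, hq⟩ := this
      have lt : ∀ p q : Submodule A G, IsCompl p q → q ≠ ⊥ → Module.finrank k p < n :=
        fun p q hpq hq => by
          have hlt : p.restrictScalars k < ⊤ := lt_top_iff_ne_top.2 fun h => hq <| by
            have : p = ⊤ := (Submodule.restrictScalars_eq_top_iff k A G).1 h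
            rw [this] at hpq
            simpa using hpq.inf_eq_bot
          exact hn ▸ Submodule.finrank_lt hlt.ne
      have epq := p.prodEquivOfIsCompl q hpq
      have eqp := q.prodEquivOfIsCompl p hpq.symm
      exact ((ih _ (lt p q hpq hq) p ((hG.congr epq.symm).of_prod k) rfl).prod
        (ih _ (lt q p hpq.symm hp) q ((hG.congr eqp.symm).of_prod k) rfl)).congr epq
  let _ : Module k G := Module.compHom G (algebraMap k A)
  have := isScalarTower_compHom k A G
  exact key _ G hG rfl

lemma IsGorensteinProjectiveGenerator.finite [IsNoetherianRing A]
    (hE : IsGorensteinProjectiveGenerator A E) : Module.Finite A E := by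
  obtain ⟨m, F, h, -, -, ⟨e⟩⟩ := hE
  have := fun i => (h i).1.finite
  exact Module.Finite.equiv e.symm

/-- A map out of the generator lifts along `p` as soon as its restrictions to the
Gorenstein-projective modules mapping to the generator do. -/
lemma IsGorensteinProjectiveGenerator.exists_lift {Z W : Type u} [AddCommGroup Z] [Module A Z]
    [AddCommGroup W] [Module A W] (hE : IsGorensteinProjectiveGenerator A E) (p : Z →ₗ[A] W)
    (h : E →ₗ[A] W)
    (H : ∀ (G : Type u) [AddCommGroup G] [Module A G], IsGorensteinProjective A G →
      ∀ t : G →ₗ[A] E, ∃ g : G →ₗ[A] Z, p ∘ₗ g = h ∘ₗ t) :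
    ∃ g : E →ₗ[A] Z, p ∘ₗ g = h := by
  obtain ⟨m, F, hF, -, -, ⟨e⟩⟩ := hE
  choose g hg using fun i => H (F i) (hF i).1
    (e.symm.toLinearMap ∘ₗ DirectSum.lof A (Fin m) (fun i => F i) i)
  refine ⟨DirectSum.toModule A (Fin m) Z g ∘ₗ e.toLinearMap, ?_⟩
  have : p ∘ₗ DirectSum.toModule A (Fin m) Z g = h ∘ₗ e.symm.toLinearMap :=
    DirectSum.linearMap_ext _ fun i => by
      ext x
      simpa using LinearMap.congr_fun (hg i) x
  rw [← LinearMap.comp_assoc, this]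
  ext x
  simp

end AddClosure

/-! ### Minimal projective presentations and the translation -/

section Translation

/-- Right minimal epimorphisms from projective modules onto the same module are isomorphic. -/
lemma RightMinimal.exists_equiv {R : Type u} [Ring R] {X X' Y : Type u} [AddCommGroup X]
    [Module R X] [AddCommGroup X'] [Module R X'] [AddCommGroup Y] [Module R Y]
    [Module.Projective R X] [Module.Projective R X'] {f : X →ₗ[R] Y} {f' : X' →ₗ[R] Y}
    (hf : RightMinimal f) (hf' : RightMinimal f') (hs : Function.Surjective f)
    (hs' : Function.Surjective f') : ∃ e : X ≃ₗ[R] X', f' ∘ₗ e.toLinearMap = f := by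
  obtain ⟨a, ha⟩ := Module.projective_lifting_property f' f hs'
  obtain ⟨b, hb⟩ := Module.projective_lifting_property f f' hs
  have h1 : Function.Bijective (b ∘ₗ a) := hf _ (by rw [← LinearMap.comp_assoc, hb, ha])
  have h2 : Function.Bijective (a ∘ₗ b) := hf' _ (by rw [← LinearMap.comp_assoc, ha, hb])
  have h3 : Function.Bijective a :=
    ⟨Function.Injective.of_comp (f := b) h1.1, Function.Surjective.of_comp (g := b) h2.2⟩
  exact ⟨LinearEquiv.ofBijective a h3, ha⟩

/-- An isomorphism of maps induces an isomorphism of their kernels. -/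
lemma nonempty_ker_equiv {R : Type u} [Ring R] {T₁ T₀ S₁ S₀ : Type u} [AddCommGroup T₁]
    [Module R T₁] [AddCommGroup T₀] [Module R T₀] [AddCommGroup S₁] [Module R S₁]
    [AddCommGroup S₀] [Module R S₀] {a : T₁ →ₗ[R] T₀} {b : S₁ →ₗ[R] S₀} (e₁ : T₁ ≃ₗ[R] S₁)
    (e₀ : T₀ ≃ₗ[R] S₀) (h : ∀ x, b (e₁ x) = e₀ (a x)) :
    Nonempty (LinearMap.ker a ≃ₗ[R] LinearMap.ker b) := by
  refine ⟨e₁.ofSubmodules _ _ ?_⟩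
  ext y
  simp only [Submodule.mem_map, LinearMap.mem_ker]
  constructor
  · rintro ⟨x, hx, rfl⟩
    exact (h x).trans (by rw [hx, map_zero])
  · intro hy
    refine ⟨e₁.symm y, ?_, e₁.apply_symm_apply y⟩
    apply e₀.injective
    rw [← h, e₁.apply_symm_apply, hy, map_zero]

variable (k : Type u) [Field k] {B : Type u} [Ring B] [Algebra k B]

/-- The isomorphism `D Hom_B(P, B) ≅ D Hom_B(Q, B)` induced by `P ≅ Q`. -/
def DHomRegular.congr {P Q : Type u} [AddCommGroup P] [Module B P] [AddCommGroup Q] [Module B Q]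
    (e : P ≃ₗ[B] Q) : DHomRegular k B P ≃ₗ[B] DHomRegular k B Q :=
  LinearEquiv.ofLinearMap (DHomRegular.map k B e.toLinearMap)
    (DHomRegular.map k B e.symm.toLinearMap)
    (LinearMap.ext fun φ => LinearMap.ext fun h => congrArg φ.toDual <| LinearMap.ext fun x =>
      congrArg h (e.apply_symm_apply x))
    (LinearMap.ext fun φ => LinearMap.ext fun h => congrArg φ.toDual <| LinearMap.ext fun x =>
      congrArg h (e.symm_apply_apply x))

variable {N : Type u} [AddCommGroup N] [Module B N]

lemma MinimalProjPresentation.nonempty_tau_equiv (Q Q' : MinimalProjPresentation B N) :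
    Nonempty (tau k Q ≃ₗ[B] tau k Q') := by
  have := Q.projective₀
  have := Q'.projective₀
  have := Q.projective₁
  have := Q'.projective₁
  obtain ⟨e₀, he₀⟩ := Q.minimal₀.exists_equiv Q'.minimal₀ Q.surjective Q'.surjective
  have hπ : ∀ x, Q'.π (e₀ x) = Q.π x := fun x => LinearMap.congr_fun he₀ x
  -- `P₁ → Im σ` composed with the isomorphism `Im σ ≅ Im σ'` induced by `e₀`
  let f : Q.P₁ →ₗ[B] LinearMap.range Q'.σ :=
    (e₀.toLinearMap ∘ₗ Q.σ).codRestrict _ fun x => (Q'.exact _).1 <|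
      (hπ _).trans (Q.exact.apply_apply_eq_zero x)
  have hf : RightMinimal f := fun h hh => Q.minimal₁ h <| LinearMap.ext fun x =>
    Subtype.ext <| e₀.injective <| congrArg Subtype.val (LinearMap.congr_fun hh x)
  have hfs : Function.Surjective f := fun y => by
    obtain ⟨x, hx⟩ := (Q.exact (e₀.symm y)).1 <| by
      rw [← hπ, e₀.apply_symm_apply]
      exact (Q'.exact _).2 y.2
    refine ⟨x, Subtype.ext ?_⟩
    change e₀ (Q.σ x) = y
    rw [hx, e₀.apply_symm_apply]
  obtain ⟨e₁, he₁⟩ := hf.exists_equiv Q'.minimal₁ hfs (LinearMap.surjective_rangeRestrict _)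
  have hσ : Q'.σ ∘ₗ e₁.toLinearMap = e₀.toLinearMap ∘ₗ Q.σ := LinearMap.ext fun x =>
    congrArg Subtype.val (LinearMap.congr_fun he₁ x)
  exact nonempty_ker_equiv (DHomRegular.congr k e₁) (DHomRegular.congr k e₀) fun φ =>
    LinearMap.ext fun h => congrArg φ.toDual (congrArg (fun t => h ∘ₗ t) hσ)

lemma exists_dualBasis (P : Type u) [AddCommGroup P] [Module B P] [Module.Finite B P]
    [Module.Projective B P] :
    ∃ (n : ℕ) (p : Fin n → P) (s : Fin n → P →ₗ[B] B), ∀ x, ∑ i, s i x • p i = x := by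
  obtain ⟨n, r, s, -, -, hrs⟩ := Module.Finite.exists_comp_eq_id_of_projective B P
  refine ⟨n, fun i => r (Pi.single i 1), fun i => LinearMap.proj i ∘ₗ s, fun x => ?_⟩
  have := LinearMap.congr_fun hrs x
  rw [LinearMap.comp_apply, pi_eq_sum_univ' (s x), map_sum] at this
  simpa [LinearMap.map_smul] using this

/-- For finitely generated projective modules, `Hom(X, D Hom(P, B)) ≅ D Hom(P, X)` naturally, so
that `Hom(X, Ker(D Hom(σ, B)))` is dual to the cokernel of `Hom(σ, X)`. -/
lemma forall_hom_ker_eq_zero_iff {P₁ P₀ X : Type u} [AddCommGroup P₁] [Module B P₁]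
    [AddCommGroup P₀] [Module B P₀] [AddCommGroup X] [Module B X] [Module.Finite B P₁]
    [Module.Projective B P₁] [Module.Finite B P₀] [Module.Projective B P₀] (σ : P₁ →ₗ[B] P₀) :
    (∀ φ : X →ₗ[B] LinearMap.ker (DHomRegular.map k B σ), φ = 0) ↔
      Function.Surjective fun g : P₀ →ₗ[B] X => g ∘ₗ σ := by
  let _ : Module k X := Module.compHom X (algebraMap k B)
  have := isScalarTower_compHom k B X
  constructor
  · intro hφ
    by_contra hns
    have hlt : LinearMap.range (LinearMap.lcomp k X σ) < ⊤ :=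
      lt_top_iff_ne_top.2 fun h => hns (LinearMap.range_eq_top.1 h)
    obtain ⟨Φ, hΦ, hle⟩ := Submodule.exists_le_ker_of_lt_top _ hlt
    -- the map `X → D Hom(P₁, B)` adjoint to the functional `Φ` on `Hom(P₁, X)`
    let ψ : X →ₗ[B] DHomRegular k B P₁ :=
      { toFun := fun x =>
          ({ toFun := fun h => Φ (LinearMap.toSpanSingleton B X x ∘ₗ h)
             map_add' := fun g h => by rw [LinearMap.comp_add, map_add]
             map_smul' := fun c h => by
              rw [RingHom.id_apply, ← map_smul]
              congr 1
              ext p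
              simp } : Module.Dual k (P₁ →ₗ[B] B))
        map_add' := fun x y => LinearMap.ext fun h => by
          refine Eq.trans (congrArg Φ ?_) (map_add Φ _ _)
          ext p
          simp
        map_smul' := fun b x => LinearMap.ext fun h => congrArg Φ <| LinearMap.ext fun p => by
          simp [rightMul, mul_smul] }
    have hψ : ∀ x, ψ x ∈ LinearMap.ker (DHomRegular.map k B σ) := fun x =>
      LinearMap.ext fun h => hle ⟨LinearMap.toSpanSingleton B X x ∘ₗ h, rfl⟩
    have hz := hφ (ψ.codRestrict _ hψ)
    apply hΦ
    obtain ⟨n, p, s, hps⟩ := exists_dualBasis (B := B) P₁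
    refine LinearMap.ext fun g => ?_
    have hg : g = ∑ i, LinearMap.toSpanSingleton B X (g (p i)) ∘ₗ s i := LinearMap.ext fun x => by
      conv_lhs => rw [← hps x]
      simp [LinearMap.sum_apply]
    rw [hg, map_sum]
    refine Finset.sum_eq_zero fun i _ => ?_
    have := congrArg Subtype.val (LinearMap.congr_fun hz (g (p i)))
    exact LinearMap.congr_fun (show (ψ (g (p i))).toDual = 0 from this) (s i)
  · intro hs φ
    obtain ⟨n, p, s, hps⟩ := exists_dualBasis (B := B) P₁
    obtain ⟨m, q, t, hqt⟩ := exists_dualBasis (B := B) P₀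
    have hsmul : ∀ (x : X) (b : B) (h : P₁ →ₗ[B] B),
        DHomRegular.toDual k B (φ (b • x)).1 h =
          DHomRegular.toDual k B (φ x).1 (rightMul k B P₁ b h) := fun x b h => by
      rw [map_smul]; rfl
    have hadd : ∀ (h : P₁ →ₗ[B] B) {ι : Type} (S : Finset ι) (x : ι → X),
        DHomRegular.toDual k B (φ (∑ i ∈ S, x i)).1 h =
          ∑ i ∈ S, DHomRegular.toDual k B (φ (x i)).1 h := fun h ι S x => by
      let ev : X →+ k :=
        { toFun := fun x => DHomRegular.toDual k B (φ x).1 h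
          map_zero' := by rw [map_zero]; rfl
          map_add' := fun x y => by rw [map_add]; rfl }
      exact map_sum ev x S
    -- the functional on `Hom(P₁, X)` adjoint to `φ` vanishes on the image of `Hom(σ, X)`
    have h0 : ∀ g : P₁ →ₗ[B] X, ∑ i, DHomRegular.toDual k B (φ (g (p i))).1 (s i) = 0 := by
      intro g
      obtain ⟨g, rfl⟩ := hs g
      have e1 : ∀ i, DHomRegular.toDual k B (φ (g (σ (p i)))).1 (s i) =
          ∑ j, DHomRegular.toDual k B (φ (g (q j))).1 
            (rightMul k B P₁ (t j (σ (p i))) (s i)) := fun i => by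
        conv_lhs => rw [← hqt (σ (p i)), map_sum, hadd]
        simp_rw [map_smul g, hsmul]
      simp only [LinearMap.comp_apply]
      simp_rw [e1]
      rw [Finset.sum_comm]
      refine Finset.sum_eq_zero fun j _ => ?_
      rw [← map_sum]
      have e2 : ∑ i, rightMul k B P₁ (t j (σ (p i))) (s i) = t j ∘ₗ σ := LinearMap.ext fun x => by
        conv_rhs => rw [← hps x]
        simp [LinearMap.sum_apply, rightMul]
      rw [e2]
      exact LinearMap.congr_fun (show (DHomRegular.map k B σ (φ (g (q j))).1).toDual = 0 from
        (φ (g (q j))).2) (t j)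
    refine LinearMap.ext fun x => Subtype.ext <| LinearMap.ext fun h => ?_
    refine Eq.trans ?_ (h0 (LinearMap.toSpanSingleton B X x ∘ₗ h))
    simp only [LinearMap.comp_apply, LinearMap.toSpanSingleton_apply]
    simp_rw [hsmul]
    rw [← map_sum]
    refine congrArg (DHomRegular.toDual k B (φ x).1) (LinearMap.ext fun y => ?_)
    conv_lhs => rw [← hps y]
    simp [LinearMap.sum_apply, rightMul]

end Translation

/-! ### The functor `Hom(E, -)` -/

section HomFunctor

variable {A : Type u} [Ring A] (E : Type u) [AddCommGroup E] [Module A E]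
  {M N G : Type u} [AddCommGroup M] [Module A M] [AddCommGroup N] [Module A N] [AddCommGroup G]
  [Module A G]

/-- The functor `Hom(E, -)` from `A`-modules to `End(E)ᵒᵖ`-modules, on morphisms. -/
def homMap (f : M →ₗ[A] N) : (E →ₗ[A] M) →ₗ[CMAuslander A E] (E →ₗ[A] N) where
  toFun h := f ∘ₗ h
  map_add' _ _ := LinearMap.comp_add _ _ _
  map_smul' _ _ := rfl

/-- The regular module over `End(E)ᵒᵖ` is `Hom(E, E)`. -/
def homSelfEquiv : (E →ₗ[A] E) ≃ₗ[CMAuslander A E] CMAuslander A E where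
  toFun h := MulOpposite.op h
  invFun c := c.unop
  map_add' _ _ := rfl
  map_smul' _ _ := rfl

variable {E}

/-- `Hom(E, -)` is faithful on `add E`. -/
lemma IsInAdd.eq_of_comp_eq (hG : IsInAdd (A := A) E G) {f g : G →ₗ[A] M}
    (h : ∀ t : E →ₗ[A] G, f ∘ₗ t = g ∘ₗ t) : f = g := by
  obtain ⟨n, r, s, hrs⟩ := hG
  refine LinearMap.ext fun x => ?_
  have hx : ∑ i, r i (s i x) = x := by
    simpa [LinearMap.sum_apply] using LinearMap.congr_fun hrs x
  rw [← hx, map_sum, map_sum]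
  exact Finset.sum_congr rfl fun i _ => LinearMap.congr_fun (h (r i)) (s i x)

/-- `Hom(E, -)` is full on `add E`. -/
lemma IsInAdd.exists_homMap_eq (hG : IsInAdd (A := A) E G)
    (θ : (E →ₗ[A] G) →ₗ[CMAuslander A E] (E →ₗ[A] M)) : ∃ g : G →ₗ[A] M, homMap E g = θ := by
  obtain ⟨n, r, s, hrs⟩ := hG
  refine ⟨∑ i, θ (r i) ∘ₗ s i, LinearMap.ext fun h => ?_⟩
  have hh : h = ∑ i, (MulOpposite.op (s i ∘ₗ h) : CMAuslander A E) • r i := by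
    refine LinearMap.ext fun x => ?_
    have hx := LinearMap.congr_fun hrs (h x)
    rw [LinearMap.sum_apply] at hx ⊢
    exact hx.symm
  conv_rhs => rw [hh, map_sum]
  simp_rw [map_smul]
  refine LinearMap.ext fun x => ?_
  change (∑ i, θ (r i) ∘ₗ s i) (h x) = _
  rw [LinearMap.sum_apply, LinearMap.sum_apply]
  rfl

lemma IsInAdd.finite_projective (hG : IsInAdd (A := A) E G) :
    Module.Finite (CMAuslander A E) (E →ₗ[A] G) ∧
      Module.Projective (CMAuslander A E) (E →ₗ[A] G) := by
  obtain ⟨n, r, s, hrs⟩ := hG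
  let a : (E →ₗ[A] G) →ₗ[CMAuslander A E] (Fin n → CMAuslander A E) :=
    LinearMap.pi fun i => (homSelfEquiv E).toLinearMap ∘ₗ homMap E (s i)
  let b : (Fin n → CMAuslander A E) →ₗ[CMAuslander A E] (E →ₗ[A] G) :=
    ∑ i, LinearMap.toSpanSingleton (CMAuslander A E) _ (r i) ∘ₗ LinearMap.proj i
  have hab : b ∘ₗ a = LinearMap.id := LinearMap.ext fun h => LinearMap.ext fun x => by
    have hx := LinearMap.congr_fun hrs (h x)
    rw [LinearMap.sum_apply] at hx
    simp only [b, LinearMap.comp_apply, LinearMap.sum_apply]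
    exact hx
  exact ⟨Module.Finite.of_surjective b fun h => ⟨a h, LinearMap.congr_fun hab h⟩,
    Module.Projective.of_split a b hab⟩

/-- `Hom(E, -)` preserves right minimality of maps out of `add E`. -/
lemma RightMinimal.homMap {f : G →ₗ[A] M} (hf : RightMinimal f) (hG : IsInAdd (A := A) E G)
    {θ : (E →ₗ[A] G) →ₗ[CMAuslander A E] (E →ₗ[A] G)}
    (hθ : GorensteinTau.homMap E f ∘ₗ θ = GorensteinTau.homMap E f) : Function.Bijective θ := by
  obtain ⟨g, rfl⟩ := hG.exists_homMap_eq θ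
  have hg : f ∘ₗ g = f := hG.eq_of_comp_eq fun t => LinearMap.congr_fun hθ t
  let e := LinearEquiv.ofBijective g (hf g hg)
  refine ⟨fun h h' hh => LinearMap.ext fun x => e.injective (LinearMap.congr_fun hh x), fun h =>
    ⟨e.symm.toLinearMap ∘ₗ h, LinearMap.ext fun x => e.apply_symm_apply (h x)⟩⟩

/-- `Hom(E, -)` takes a minimal proper Gorenstein-projective presentation to a minimal projective
presentation. -/
def homPresentation (hE : IsGorensteinProjectiveGenerator A E) (P : MinimalGprojPresentation A M)
    (h₁ : IsInAdd (A := A) E P.G₁) (h₀ : IsInAdd (A := A) E P.G₀) :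
    MinimalProjPresentation (CMAuslander A E) (E →ₗ[A] M) where
  P₁ := ModuleCat.of _ (E →ₗ[A] P.G₁)
  P₀ := ModuleCat.of _ (E →ₗ[A] P.G₀)
  σ := homMap E P.f
  π := homMap E P.π
  finite₁ := h₁.finite_projective.1
  finite₀ := h₀.finite_projective.1
  projective₁ := h₁.finite_projective.2
  projective₀ := h₀.finite_projective.2
  exact h := by
    refine ⟨fun hh => hE.exists_lift P.f h fun G _ _ hG t => ?_, ?_⟩
    · exact (P.proper_exact G hG (h ∘ₗ t)).1 (congrArg (fun s => s ∘ₗ t) hh)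
    · rintro ⟨g, rfl⟩
      exact LinearMap.ext fun x => P.exact.apply_apply_eq_zero (g x)
  surjective h := hE.exists_lift P.π h fun G _ _ hG t => P.proper_surjective G hG (h ∘ₗ t)
  minimal₁ θ hθ := by
    have hf : RightMinimal P.f := fun g hg => P.minimal₁ g <| LinearMap.ext fun x =>
      Subtype.ext <| LinearMap.congr_fun hg x
    exact hf.homMap h₁ <| LinearMap.ext fun x => congrArg Subtype.val (LinearMap.congr_fun hθ x)
  minimal₀ _ hθ := P.minimal₀.homMap h₀ hθ

end HomFunctor

/-! ### Comparison of the two translations -/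

section Comparison

variable (k : Type u) [Field k] {A : Type u} [Ring A] [Algebra k A]
  {E : Type u} [AddCommGroup E] [Module k E] [Module A E] [IsScalarTower k A E]
  {M G : Type u} [AddCommGroup M] [Module A M] [AddCommGroup G] [Module A G]

/-- The isomorphism `Hom(G, E) ≅ Hom(Hom(E, G), End(E)ᵒᵖ)` induced by `Hom(E, -)` for `G` in
`add E`. -/
noncomputable def IsInAdd.homEquiv (hG : IsInAdd (A := A) E G) :
    (G →ₗ[A] E) ≃ₗ[k] ((E →ₗ[A] G) →ₗ[CMAuslander A E] CMAuslander A E) :=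
  LinearEquiv.ofBijective
    { toFun := fun g => (homSelfEquiv E).toLinearMap ∘ₗ homMap E g
      map_add' := fun _ _ => rfl
      map_smul' := fun _ _ => rfl }
    ⟨fun f g h => hG.eq_of_comp_eq fun t =>
      (homSelfEquiv E).injective (LinearMap.congr_fun h t), fun θ => by
      obtain ⟨g, hg⟩ := hG.exists_homMap_eq ((homSelfEquiv E).symm.toLinearMap ∘ₗ θ)
      refine ⟨g, LinearMap.ext fun h => ?_⟩
      exact (congrArg (homSelfEquiv E) (LinearMap.congr_fun hg h)).trans
        ((homSelfEquiv E).apply_symm_apply _)⟩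

/-- The `End(E)ᵒᵖ`-linear dual of `IsInAdd.homEquiv`. -/
noncomputable def IsInAdd.dHomEquiv (hG : IsInAdd (A := A) E G) :
    DHom k A E G ≃ₗ[CMAuslander A E] DHomRegular k (CMAuslander A E) (E →ₗ[A] G) :=
  LinearEquiv.symm
    { toFun := fun φ => φ.toDual ∘ₗ (hG.homEquiv k).toLinearMap
      invFun := fun φ => φ.toDual ∘ₗ (hG.homEquiv k).symm.toLinearMap
      left_inv := fun φ => LinearMap.ext fun h =>
        congrArg φ.toDual ((hG.homEquiv k).apply_symm_apply h)
      right_inv := fun φ => LinearMap.ext fun h =>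
        congrArg φ.toDual ((hG.homEquiv k).symm_apply_apply h)
      map_add' := fun _ _ => rfl
      map_smul' := fun _ _ => rfl }

lemma nonempty_tauG_equiv (hE : IsGorensteinProjectiveGenerator A E)
    (P : MinimalGprojPresentation A M) (h₁ : IsInAdd (A := A) E P.G₁)
    (h₀ : IsInAdd (A := A) E P.G₀) :
    Nonempty (tauG k A E P ≃ₗ[CMAuslander A E] tau k (homPresentation hE P h₁ h₀)) := by
  obtain ⟨e⟩ := nonempty_ker_equiv (a := DHomRegular.map k (CMAuslander A E) (homMap E P.f))
    (b := DHom.map k A E P.f) (h₁.dHomEquiv k).symm (h₀.dHomEquiv k).symm fun _ => rfl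
  exact ⟨e.symm⟩

end Comparison

/-! ### Relative rigidity -/

section Rigidity

lemma forall_hom_eq_zero_congr {R : Type u} [Ring R] {X T T' : Type u} [AddCommGroup X]
    [Module R X] [AddCommGroup T] [Module R T] [AddCommGroup T'] [Module R T'] (e : T ≃ₗ[R] T') :
    (∀ φ : X →ₗ[R] T, φ = 0) ↔ ∀ φ : X →ₗ[R] T', φ = 0 := by
  refine ⟨fun h φ => ?_, fun h φ => ?_⟩
  · ext x
    exact e.symm.map_eq_zero_iff.1 (LinearMap.congr_fun (h (e.symm.toLinearMap ∘ₗ φ)) x)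
  · ext x
    exact e.map_eq_zero_iff.1 (LinearMap.congr_fun (h (e.toLinearMap ∘ₗ φ)) x)

lemma injStableHomZero_of_forall_eq_zero {R : Type u} [Ring R] {X T : Type u} [AddCommGroup X]
    [Module R X] [AddCommGroup T] [Module R T] (h : ∀ φ : X →ₗ[R] T, φ = 0) :
    InjStableHomZero R X T := fun φ =>
  ⟨ModuleCat.of R PUnit.{u + 1}, 0, 0, inferInstanceAs (Module.Finite R PUnit.{u + 1}),
    ⟨fun _ _ _ _ _ _ _ _ _ => ⟨0, fun _ => Subsingleton.elim (α := PUnit) _ _⟩⟩,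
    by rw [h φ]; ext; simp⟩

variable {A : Type u} [Ring A] {E M T Y : Type u} [AddCommGroup E] [Module A E] [AddCommGroup M]
  [Module A M] [AddCommGroup Y] [Module A Y] [AddCommGroup T] [Module (CMAuslander A E) T]

/-- Maps out of `Hom(E, M)` vanish if and only if maps out of `Hom(E, M⁽ᴵ⁾)` do, because
`Hom(E, -)` commutes with direct sums for finitely generated `E`. -/
lemma hom_finsupp_eq_zero [Module.Finite A E]
    (h : ∀ φ : (E →ₗ[A] M) →ₗ[CMAuslander A E] T, φ = 0) (I : Type u)
    (φ : (E →ₗ[A] (I →₀ M)) →ₗ[CMAuslander A E] T) : φ = 0 := by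
  classical
  refine LinearMap.ext fun g => ?_
  obtain ⟨S, hS⟩ := Module.Finite.fg_top (R := A) (M := E)
  have hg : g = ∑ i ∈ S.biUnion fun x => (g x).support,
      homMap E (Finsupp.lsingle i) (Finsupp.lapply i ∘ₗ g) := by
    refine LinearMap.ext_on (s := (S : Set E)) hS fun x hx => ?_
    rw [LinearMap.sum_apply]
    change g x = ∑ i ∈ _, Finsupp.single i (g x i)
    rw [← Finset.sum_subset (Finset.subset_biUnion_of_mem (fun x => (g x).support) hx)]
    · exact (Finsupp.sum_single (g x)).symm
    · intro i _ hi
      rw [Finsupp.notMem_support_iff.1 hi, Finsupp.single_zero]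
  rw [hg, map_sum]
  exact Finset.sum_eq_zero fun i _ =>
    LinearMap.congr_fun (h (φ ∘ₗ homMap E (Finsupp.lsingle i))) _

/-- Maps out of `Hom(E, Y)` vanish for `Y ∈ Gen_G M` if those out of `Hom(E, M)` do: `Hom(E, Y)`
is a quotient of `Hom(E, T₀)`, which is a summand of `Hom(E, M⁽ᴵ⁾)`. -/
lemma GenG.hom_eq_zero [Module.Finite A E] (hE : IsGorensteinProjectiveGenerator A E)
    (hY : GenG A M Y) (h : ∀ φ : (E →ₗ[A] M) →ₗ[CMAuslander A E] T, φ = 0)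
    (φ : (E →ₗ[A] Y) →ₗ[CMAuslander A E] T) : φ = 0 := by
  obtain ⟨I, T₀, s, r, p, hrs, -, hp⟩ := hY
  refine LinearMap.ext fun g => ?_
  obtain ⟨g, rfl⟩ := hE.exists_lift p g fun G _ _ hG t => hp G hG (g ∘ₗ t)
  have := LinearMap.congr_fun
    (hom_finsupp_eq_zero h I (φ ∘ₗ homMap E p ∘ₗ homMap E r)) (s ∘ₗ g)
  refine Eq.trans (congrArg φ ?_) this
  have hg : r ∘ₗ s ∘ₗ g = g := by rw [← LinearMap.comp_assoc, hrs, LinearMap.id_comp]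
  exact congrArg (fun t => p ∘ₗ t) hg.symm

/-- `Hom(E, Y)` is finite-dimensional over the ground field, hence finitely generated. -/
lemma finite_cmAuslander_hom (k : Type u) [Field k] [Algebra k A] [Module.Finite k A]
    [Module k E] [IsScalarTower k A E] [Module.Finite A E] [Module.Finite A Y] :
    Module.Finite (CMAuslander A E) (E →ₗ[A] Y) := by
  let _ : Module k Y := Module.compHom Y (algebraMap k A)
  have := isScalarTower_compHom k A Y
  have := finite_hom k (A := A) E Y
  have : IsScalarTower k (CMAuslander A E) (E →ₗ[A] Y) := ⟨fun c a h => LinearMap.ext fun x => by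
    change h (c • a.unop x) = c • h (a.unop x)
    exact LinearMap.map_smul_of_tower h c _⟩
  exact Module.Finite.of_restrictScalars_finite k _ _

end Rigidity

end GorensteinTau

open GorensteinTau in
theorem proposition2p10 (k A : Type u) [Field k] [Ring A] [Algebra k A] [Module.Finite k A]
    (E : Type u) [AddCommGroup E] [Module k E] [Module A E] [IsScalarTower k A E]
    (hE : IsGorensteinProjectiveGenerator A E)
    (M : Type u) [AddCommGroup M] [Module A M] [Module.Finite A M]
    (P : MinimalGprojPresentation A M) :
    (IsTauGRigid k A E M ↔ Function.Surjective (fun h : P.G₀ →ₗ[A] M => h ∘ₗ P.f)) ∧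
    (IsTauGRigid k A E M ↔ IsTauRigid k (CMAuslander A E) (E →ₗ[A] M)) ∧
    (Nonempty (MinimalProjPresentation (CMAuslander A E) (E →ₗ[A] M)) ∧
      ∀ Q : MinimalProjPresentation (CMAuslander A E) (E →ₗ[A] M),
        Nonempty (tauG k A E P ≃ₗ[CMAuslander A E] tau k Q)) ∧
    (IsTauGRigid k A E M → ∀ (Y : Type u) [AddCommGroup Y] [Module A Y], GenG A M Y →
      InjStableHomZero (CMAuslander A E) (E →ₗ[A] Y) (tauG k A E P) ∧
      (Module.Finite A Y → Module.Finite (CMAuslander A E) (E →ₗ[A] Y))) := by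
  have := isNoetherianRing_of_finite_algebra k (A := A)
  have : Module.Finite A E := hE.finite
  have h₁ := fun P : MinimalGprojPresentation A M => hE.isInAdd k P.gproj₁
  have h₀ := fun P : MinimalGprojPresentation A M => hE.isInAdd k P.gproj₀
  have hτ : ∀ (P : MinimalGprojPresentation A M)
      (Q : MinimalProjPresentation (CMAuslander A E) (E →ₗ[A] M)),
      Nonempty (tauG k A E P ≃ₗ[CMAuslander A E] tau k Q) := fun P Q => by
    obtain ⟨e⟩ := nonempty_tauG_equiv k hE P (h₁ P) (h₀ P)
    obtain ⟨e'⟩ := (homPresentation hE P (h₁ P) (h₀ P)).nonempty_tau_equiv k Q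
    exact ⟨e.trans e'⟩
  have hrigid : IsTauGRigid k A E M ↔
      ∀ φ : (E →ₗ[A] M) →ₗ[CMAuslander A E] tauG k A E P, φ = 0 := by
    refine ⟨fun ⟨P', hP'⟩ => ?_, fun h => ⟨P, h⟩⟩
    obtain ⟨e⟩ := hτ P' (homPresentation hE P (h₁ P) (h₀ P))
    obtain ⟨e'⟩ := hτ P (homPresentation hE P (h₁ P) (h₀ P))
    exact (forall_hom_eq_zero_congr (e.trans e'.symm)).1 hP'
  refine ⟨?_, ?_, ⟨⟨homPresentation hE P (h₁ P) (h₀ P)⟩, hτ P⟩, fun hM Y _ _ hY =>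
    ⟨injStableHomZero_of_forall_eq_zero (hY.hom_eq_zero hE (hrigid.1 hM)),
      fun _ => finite_cmAuslander_hom k⟩⟩
  · obtain ⟨e⟩ := nonempty_tauG_equiv k hE P (h₁ P) (h₀ P)
    obtain ⟨hf₁, hp₁⟩ := (h₁ P).finite_projective
    obtain ⟨hf₀, hp₀⟩ := (h₀ P).finite_projective
    rw [hrigid, forall_hom_eq_zero_congr e]
    refine (forall_hom_ker_eq_zero_iff k (homMap E P.f)).trans ⟨fun h g => ?_, fun h θ => ?_⟩
    · obtain ⟨θ, hθ⟩ := h (homMap E g)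
      obtain ⟨g', rfl⟩ := (h₀ P).exists_homMap_eq θ
      exact ⟨g', (h₁ P).eq_of_comp_eq fun t => LinearMap.congr_fun hθ t⟩
    · obtain ⟨g, rfl⟩ := (h₁ P).exists_homMap_eq θ
      obtain ⟨g', rfl⟩ := h g
      exact ⟨homMap E g', rfl⟩
  · rw [hrigid]
    refine ⟨fun h => ⟨homPresentation hE P (h₁ P) (h₀ P), ?_⟩, fun ⟨Q, hQ⟩ => ?_⟩
    · obtain ⟨e⟩ := hτ P (homPresentation hE P (h₁ P) (h₀ P))
      exact (forall_hom_eq_zero_congr e).1 h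
    · obtain ⟨e⟩ := hτ P Q
      exact (forall_hom_eq_zero_congr e).2 hQ
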